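/- Let $n\ge 1$, let $\mathbb R_n$ be the real Clifford algebra with units $e_1,\dots,e_n$, $e_ie_j+e_je_i=-2\delta_{ij}$, and identify $\mathbb R^{n+1}$ (with Euclidean norm $|\cdot|$) with the paravectors $s=s_0+\sum_{j=1}^n s_je_j\in\mathbb R_n$; put $\overline s=s_0-\sum_{j=1}^n s_je_j$. Let $V$ be a real Banach space, and let $V_n=V\otimes\mathbb R_n$ with elements $\sum_A v_Ae_A$ ($A\subseteq\{1,\dots,n\}$) and norm $\|\sum_A v_Ae_A\|^2=\sum_A\|v_A\|^2$. Let $\mathcal B(V_n)$ be the algebra of bounded $\mathbb R$-linear operators on $V_n$ with the operator norm and identity $\mathcal I$; an element $a\in\mathbb R_n$ acts on $V_n$ by left multiplication, $a\sum_A v_Ae_A=\sum_A v_A(ae_A)$, and is identified with this operator. Let $\mathcal B^{0,1}(V_n)\subset\mathcal B(V_n)$ be the set of bounded paravector operators $T=T_0+\sum_{j=1}^n e_jT_j$, where the $T_j$ are bounded linear operators on $V$ and $T(\sum_B v_Be_B)=\sum_B T_0(v_B)e_B+\sum_{j=1}^n\sum_B T_j(v_B)e_je_B$. For $T\in\mathcal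 B^{0,1}(V_n)$ and $s\in\mathbb R^{n+1}$ put $Q_s(T)=T^2-2s_0T+|s|^2\mathcal I$, let $\sigma_S(T)$ be the set of $s\in\mathbb R^{n+1}$ for which $Q_s(T)$ is not invertible in $\mathcal B(V_n)$, and let $\rho_S(T)=\mathbb R^{n+1}\setminus\sigma_S(T)$. For $s\in\rho_S(T)$ let $$S_L^{-1}(s,T)=-Q_s(T)^{-1}(T-\overline s\,\mathcal I),\qquad S_R^{-1}(s,T)=-(T-\overline s\,\mathcal I)Q_s(T)^{-1},$$ and for $m\ge 0$ $$S_L^{-m}(s,T)=Q_s(T)^{-m}(\overline s\,\mathcal I-T)^{\star_\ell m},\qquad S_R^{-m}(s,T)=(\overline s\,\mathcal I-T)^{\star_r m}Q_s(T)^{-m},$$ where the powers are taken with respect to the products $\big(\sum_k T^ka_k\big)\star_\ell\big(\sum_k T^kb_k\big)=\sum_k T^k\big(\sum_{i=0}^k a_ib_{k-i}\big)$ and $\big(\sum_k a_kT^k\big)\star_r\big(\sum_k b_kT^k\big)=\sum_k\big(\sum_{i=0}^k a_ib_{k-i}\big)T^k$ of polynomial expressions with coefficients $a_k,b_k\in\mathbb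 R_n$. Distances are $\mathrm{dist}(C,A)=\inf\{|x-y|:x\in C,\ y\in A\}$ (equal to $\infty$ if $C$ or $A$ is empty), and $\mathrm{dist}(s,A)=\mathrm{dist}(\{s\},A)$. **Theorem.** Let $\varepsilon>0$ and let $T,N\in\mathcal B^{0,1}(V_n)$ be such that $TN=NT$ and $\sigma_S(N)\subset B_\varepsilon(0)=\{s\in\mathbb R^{n+1}:|s|<\varepsilon\}$. Then, for every $s\in\rho_S(T)$ with $\mathrm{dist}(s,\sigma_S(T))>\varepsilon$, one has $s\in\rho_S(T+N)$ and $$S_L^{-1}(s,T+N)=\sum_{m=0}^\infty N^m\,S_L^{-(m+1)}(s,T),\qquad S_R^{-1}(s,T+N)=\sum_{m=0}^\infty S_R^{-(m+1)}(s,T)\,N^m,$$ where both series converge (unconditionally) in the operator norm. Moreover, both series converge uniformly, in the operator norm, on any set $C\subset\mathbb R^{n+1}$ with $\mathrm{dist}(C,\sigma_S(T))>\varepsilon$. -/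

import Mathlib

open scoped symmDiff

noncomputable section

namespace SCalc

/-! ### Paravectors -/

/-- Paravectors `x₀ + x₁ e₁ + ⋯ + xₙ eₙ`, identified with the points of `ℝⁿ⁺¹`
(with the Euclidean norm). -/
abbrev Paravector (n : ℕ) : Type := EuclideanSpace ℝ (Fin (n + 1))

/-- Conjugation `x₀ + x₁ e₁ + ⋯ + xₙ eₙ ↦ x₀ - x₁ e₁ - ⋯ - xₙ eₙ`. -/
def Paravector.conj {n : ℕ} (s : Paravector n) : Paravector n :=
  WithLp.toLp 2 (Fin.cons (s 0) fun j => -s j.succ)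

/-- The quadratic form `-(x₁² + ⋯ + xₙ²)`. -/
abbrev negSumSq (n : ℕ) : QuadraticForm ℝ (Fin n → ℝ) :=
  QuadraticMap.weightedSumSquares ℝ fun _ : Fin n => (-1 : ℝ)

/-- The real Clifford algebra `ℝₙ` with units `e₁, …, eₙ`, `eᵢ eⱼ + eⱼ eᵢ = -2 δᵢⱼ`. -/
abbrev Cl (n : ℕ) : Type := CliffordAlgebra (negSumSq n)

/-- The imaginary unit `eⱼ` of `ℝₙ`. -/
def imUnit {n : ℕ} (j : Fin n) : Cl n := CliffordAlgebra.ι (negSumSq n) (Pi.single j 1)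

/-- A paravector as an element of `ℝₙ`. -/
def Paravector.toCl {n : ℕ} (s : Paravector n) : Cl n :=
  algebraMap ℝ (Cl n) (s 0) + ∑ j : Fin n, s j.succ • imUnit j

/-! ### The module `Vₙ = V ⊗ ℝₙ` and its operators -/

section Module

variable (n : ℕ) (V : Type*) [NormedAddCommGroup V] [NormedSpace ℝ V]

/-- `Vₙ = V ⊗ ℝₙ`. The element `∑_A v_A e_A` is given by its coordinates `v_A ∈ V`, where `A`
runs over the subsets of `{1, …, n}`, and `‖∑_A v_A e_A‖² = ∑_A ‖v_A‖²`. -/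
def Vn : Type _ := PiLp 2 fun _ : Finset (Fin n) => V

instance : NormedAddCommGroup (Vn n V) :=
  inferInstanceAs (NormedAddCommGroup (PiLp 2 fun _ : Finset (Fin n) => V))

instance : NormedSpace ℝ (Vn n V) :=
  inferInstanceAs (NormedSpace ℝ (PiLp 2 fun _ : Finset (Fin n) => V))

/-- The coordinates `(v_A)_A` of `∑_A v_A e_A`. -/
def coords : Vn n V ≃L[ℝ] (Finset (Fin n) → V) :=
  PiLp.continuousLinearEquiv 2 ℝ fun _ : Finset (Fin n) => V

theorem norm_sq_eq (v : Vn n V) : ‖v‖ ^ 2 = ∑ A, ‖coords n V v A‖ ^ 2 :=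
  PiLp.norm_sq_eq_of_L2 (fun _ : Finset (Fin n) => V) v

/-- The bounded `ℝ`-linear operators on `Vₙ`, with composition as product and the operator norm. -/
abbrev BVn : Type _ := Vn n V →L[ℝ] Vn n V

variable {n V}

/-- The sign in `eⱼ e_B = unitSign j B • e_{B ∆ {j}}`: the unit `eⱼ` has to pass the `e_b` with
`b ∈ B`, `b < j`, and then `eⱼ² = -1` if `j ∈ B`. -/
def unitSign (j : Fin n) (B : Finset (Fin n)) : ℝ := (-1) ^ (B.filter (· ≤ j)).card

/-- The operator `∑_B v_B e_B ↦ ∑_B S(v_B) e_B` on `Vₙ` given by `S ∈ 𝓑(V)`. -/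
def coordOp (S : V →L[ℝ] V) : BVn n V :=
  (coords n V).symm.toContinuousLinearMap ∘L
    (ContinuousLinearMap.pi fun A => S ∘L ContinuousLinearMap.proj A) ∘L
      (coords n V).toContinuousLinearMap

/-- The operator `∑_B v_B e_B ↦ ∑_B v_B (eⱼ e_B) = ∑_A unitSign j (A ∆ {j}) v_{A ∆ {j}} e_A`. -/
def unitOp (V : Type*) [NormedAddCommGroup V] [NormedSpace ℝ V] (j : Fin n) : BVn n V :=
  (coords n V).symm.toContinuousLinearMap ∘L
    (ContinuousLinearMap.pi fun A =>
      unitSign j (A ∆ {j}) • ContinuousLinearMap.proj (R := ℝ) (A ∆ {j})) ∘L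
      (coords n V).toContinuousLinearMap

theorem Vn_ext {v w : Vn n V} (h : ∀ A, coords n V v A = coords n V w A) : v = w :=
  (coords n V).injective (funext h)

theorem coords_coordOp (S : V →L[ℝ] V) (v : Vn n V) (A : Finset (Fin n)) :
    coords n V (coordOp S v) A = S (coords n V v A) := rfl

theorem coords_unitOp (j : Fin n) (v : Vn n V) (A : Finset (Fin n)) :
    coords n V (unitOp V j v) A = unitSign j (A ∆ {j}) • coords n V v (A ∆ {j}) := rfl

theorem unitSign_mul_self (j : Fin n) (B : Finset (Fin n)) : unitSign j B * unitSign j B = 1 := by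
  unfold unitSign
  rw [← mul_pow]
  norm_num

theorem unitSign_symmDiff (i j : Fin n) (B : Finset (Fin n)) :
    unitSign j (B ∆ {i}) = if i ≤ j then -unitSign j B else unitSign j B := by
  unfold unitSign
  by_cases hi : i ∈ B
  · have h1 : B ∆ {i} = B.erase i := by
      ext b; simp only [Finset.mem_symmDiff, Finset.mem_singleton, Finset.mem_erase]; grind
    rw [h1, Finset.filter_erase]
    split_ifs with h
    · have hm : i ∈ B.filter (· ≤ j) := by simp [hi, h]
      rw [← Finset.card_erase_add_one hm, pow_succ]
      ring
    · rw [Finset.erase_eq_of_notMem (by simp [h])]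
  · have h1 : B ∆ {i} = insert i B := by
      ext b; simp only [Finset.mem_symmDiff, Finset.mem_singleton, Finset.mem_insert]; grind
    rw [h1, Finset.filter_insert]
    split_ifs with h
    · rw [Finset.card_insert_of_notMem (by simp [hi]), pow_succ]
      ring
    · rfl

theorem unitOp_mul_self (j : Fin n) : unitOp V j * unitOp V j = -1 := by
  refine ContinuousLinearMap.ext fun v => Vn_ext fun A => ?_
  have h : (A ∆ {j}) ∆ {j} = A := symmDiff_symmDiff_cancel_right {j} A
  change coords n V (unitOp V j (unitOp V j v)) A = -(coords n V v A)
  rw [coords_unitOp, coords_unitOp, h, smul_smul, unitSign_symmDiff, if_pos le_rfl, neg_mul,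
    unitSign_mul_self, neg_one_smul]

theorem unitOp_mul_add_mul {i j : Fin n} (hij : i ≠ j) :
    unitOp V i * unitOp V j + unitOp V j * unitOp V i = 0 := by
  refine ContinuousLinearMap.ext fun v => Vn_ext fun A => ?_
  have h : (A ∆ {j}) ∆ {i} = (A ∆ {i}) ∆ {j} := symmDiff_right_comm A {j} {i}
  change coords n V (unitOp V i (unitOp V j v)) A + coords n V (unitOp V j (unitOp V i v)) A = 0
  simp only [coords_unitOp, h, smul_smul, ← add_smul]
  rw [show unitSign i (A ∆ {i}) * unitSign j ((A ∆ {i}) ∆ {j})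
      + unitSign j (A ∆ {j}) * unitSign i ((A ∆ {i}) ∆ {j}) = 0 by
    simp only [unitSign_symmDiff]
    rcases lt_or_gt_of_ne hij with h | h
    · simp [h.le, h.not_ge]; ring
    · simp [h.le, h.not_ge]; ring, zero_smul]

theorem linearCombination_sq {n : ℕ} {A : Type*} [Ring A] [Algebra ℝ A] (E : Fin n → A)
    (h1 : ∀ i, E i * E i = -1) (h2 : ∀ i j, i ≠ j → E i * E j + E j * E i = 0) (m : Fin n → ℝ) :
    Fintype.linearCombination ℝ E m * Fintype.linearCombination ℝ E m =
      algebraMap ℝ A (negSumSq n m) := by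
  have key : ∀ i j : Fin n, E i * E j + E j * E i = if i = j then (-2 : ℝ) • (1 : A) else 0 := by
    intro i j
    split_ifs with h
    · subst h
      rw [h1]
      module
    · exact h2 i j h
  set L := Fintype.linearCombination ℝ E m with hL
  have e1 : L * L = ∑ i, ∑ j, (m i * m j) • (E i * E j) := by
    simp only [hL, Fintype.linearCombination_apply, Finset.sum_mul_sum, smul_mul_smul_comm]
  have e2 : L * L = ∑ i, ∑ j, (m i * m j) • (E j * E i) := by
    rw [e1, Finset.sum_comm]
    exact Finset.sum_congr rfl fun i _ => Finset.sum_congr rfl fun j _ => by rw [mul_comm (m j)]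
  have e3 : (2 : ℝ) • (L * L) = (2 : ℝ) • algebraMap ℝ A (negSumSq n m) := by
    rw [two_smul]
    nth_rewrite 1 [e1]
    rw [e2]
    simp only [← Finset.sum_add_distrib, ← smul_add, key, smul_ite, smul_zero,
      Finset.sum_ite_eq, Finset.mem_univ, if_true]
    rw [Algebra.algebraMap_eq_smul_one, QuadraticMap.weightedSumSquares_apply, Finset.sum_smul,
      Finset.smul_sum]
    refine Finset.sum_congr rfl fun i _ => ?_
    simp only [smul_smul, smul_eq_mul]
    congr 1
    ring
  exact smul_right_injective _ (two_ne_zero' ℝ) e3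

variable (n V) in
/-- The scalar operators `a 𝓘 : v ↦ a v` on `Vₙ`, for `a ∈ ℝₙ`. -/
def scalarOp : Cl n →ₐ[ℝ] BVn n V :=
  CliffordAlgebra.lift (negSumSq n)
    ⟨Fintype.linearCombination ℝ (unitOp V),
      linearCombination_sq _ unitOp_mul_self fun _ _ => unitOp_mul_add_mul⟩

theorem scalarOp_imUnit (j : Fin n) : scalarOp n V (imUnit j) = unitOp V j := by
  simp [scalarOp, imUnit, Fintype.linearCombination_apply_single]

/-- The paravector operator `T₀ + e₁ T₁ + ⋯ + eₙ Tₙ`, acting on `Vₙ` by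
`∑_B v_B e_B ↦ ∑_B T₀(v_B) e_B + ∑ⱼ ∑_B Tⱼ(v_B) eⱼ e_B`. -/
def paravectorOp (T : Fin (n + 1) → (V →L[ℝ] V)) : BVn n V :=
  coordOp (T 0) + ∑ j : Fin n, scalarOp n V (imUnit j) * coordOp (T j.succ)

variable (n V) in
/-- The set `𝓑⁰¹(Vₙ)` of bounded paravector operators. -/
def B01 : Set (BVn n V) := Set.range paravectorOp

/-! ### `S`-spectrum and `S`-resolvent operators -/

/-- `T² - 2 Re(s) T + |s|² 𝓘`. -/
def quadOp (s : Paravector n) (T : BVn n V) : BVn n V :=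
  T ^ 2 - (2 * s 0) • T + ‖s‖ ^ 2 • (1 : BVn n V)

/-- The `S`-spectrum of `T`. -/
def sSpectrum (T : BVn n V) : Set (Paravector n) := {s | ¬ IsUnit (quadOp s T)}

/-- The `S`-resolvent set of `T`. -/
def sResolventSet (T : BVn n V) : Set (Paravector n) := (sSpectrum T)ᶜ

/-- The left `S`-resolvent operator `-(T² - 2 Re(s) T + |s|² 𝓘)⁻¹ (T - s̄ 𝓘)`,
for `s` in the `S`-resolvent set of `T`. -/
def leftResolvent (s : Paravector n) (T : BVn n V) : BVn n V :=
  -(Ring.inverse (quadOp s T) * (T - scalarOp n V s.conj.toCl))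

/-- The right `S`-resolvent operator `-(T - s̄ 𝓘) (T² - 2 Re(s) T + |s|² 𝓘)⁻¹`,
for `s` in the `S`-resolvent set of `T`. -/
def rightResolvent (s : Paravector n) (T : BVn n V) : BVn n V :=
  -((T - scalarOp n V s.conj.toCl) * Ring.inverse (quadOp s T))

/-! ### Slice hyperholomorphic powers

The slice hyperholomorphic products of polynomials with coefficients in `ℝₙ`, both the left one,
`(∑ Tᵏ aₖ) ⋆ (∑ Tᵏ bₖ) = ∑ Tᵏ (∑_{i ≤ k} aᵢ b_{k-i})`, and the right one,
`(∑ aₖ Tᵏ) ⋆ (∑ bₖ Tᵏ) = ∑ (∑_{i ≤ k} aᵢ b_{k-i}) Tᵏ`, multiply the coefficient sequences as in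
the polynomial ring over the noncommutative ring `ℝₙ` (with a central indeterminate). -/

/-- `∑ₖ Tᵏ aₖ` for the polynomial with coefficients `aₖ ∈ ℝₙ`. -/
def leftEval (T : BVn n V) (p : Polynomial (Cl n)) : BVn n V :=
  p.sum fun k a => T ^ k * scalarOp n V a

/-- `∑ₖ aₖ Tᵏ` for the polynomial with coefficients `aₖ ∈ ℝₙ`. -/
def rightEval (T : BVn n V) (p : Polynomial (Cl n)) : BVn n V :=
  p.sum fun k a => scalarOp n V a * T ^ k

/-- The polynomial `(s̄ - x)^{⋆ m}`. -/
def starPow (s : Paravector n) (m : ℕ) : Polynomial (Cl n) :=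
  (Polynomial.C s.conj.toCl - Polynomial.X) ^ m

/-- `S_L^{-m}(s, T) = (T² - 2 Re(s) T + |s|² 𝓘)^{-m} (s̄ 𝓘 - T)^{⋆ₗ m}`,
for `s` in the `S`-resolvent set of `T`. -/
def leftResolventPow (m : ℕ) (s : Paravector n) (T : BVn n V) : BVn n V :=
  Ring.inverse (quadOp s T) ^ m * leftEval T (starPow s m)

/-- `S_R^{-m}(s, T) = (s̄ 𝓘 - T)^{⋆ᵣ m} (T² - 2 Re(s) T + |s|² 𝓘)^{-m}`,
for `s` in the `S`-resolvent set of `T`. -/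
def rightResolventPow (m : ℕ) (s : Paravector n) (T : BVn n V) : BVn n V :=
  rightEval T (starPow s m) * Ring.inverse (quadOp s T) ^ m

end Module

/-- The distance `inf {|x - y| : x ∈ A, y ∈ B}` of two sets, which is `∞` if one of them
is empty. -/
def setDist {n : ℕ} (A B : Set (Paravector n)) : ENNReal := ⨅ x ∈ A, ⨅ y ∈ B, edist x y

end SCalc

end

open SCalc

/-! ### Commuting perturbations of resolvents in complex Banach algebras. -/

section ComplexBanachAlgebra

open Filter Topology

variable {B : Type*} [NormedRing B] [NormedAlgebra ℂ B] [CompleteSpace B]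

/-! The theorem reduces to its classical complex counterpart. For commuting `t`, `ν` in a complex
Banach algebra, the resolvent `R` of `t` at `z` gives `z - (t + ν) = (1 - νR)(z - t)`, so the
resolvent of `t + ν` is `∑ ν^m R^(m+1)`. The series is dominated by a geometric one: Gelfand's
formula gives `‖ν^m‖ ≤ K r^m` with `r < ε`, and Cauchy's estimates on a disc of radius `ε` give
`‖R^(m+1)‖ ≤ M / ε^m`, uniformly in `z` (`exists_hasSum_resolvent_add`).

To transfer this, let the real algebra `A` of operators act by left multiplication on its
complexification. The quadratic `Q_z(T)` becomes `(z - t)(z̄ - t)` (`mulLeftHom_quadAt`), so the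
spectrum of `t` lies in the trace of the S-spectrum on any plane spanned by `1` and an imaginary
unit. Write `s = x + yJ`. Applying an operator to `1` and replacing `i` by right multiplication with
`J` (`evalOne`) turns `R^m` into `S_L^{-m}(s, T)`, as both obey `U_{m+1} = Q_s(T)⁻¹ (U_m s̄ - T
U_m)` with `U_0 = 1`. Being additive, continuous and compatible with left multiplication, `evalOne`
carries the complex series to the left S-resolvent series (`exists_hasSum_pow_mul`). The right
series is the left one in the opposite algebra. -/

theorem exists_norm_pow_le_of_spectrum_subset_ball (a : B) {ε : ℝ} (hε : 0 < ε)
    (h : ∀ w ∈ spectrum ℂ a, ‖w‖ < ε) :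
    ∃ r K : ℝ, 0 < r ∧ r < ε ∧ ∀ m : ℕ, ‖a ^ m‖ ≤ K * r ^ m := by
  have hlt : spectralRadius ℂ a < ENNReal.ofReal ε := by
    -- The spectrum is empty when the algebra is zero. Otherwise compactness makes the pointwise
    -- strict bound a strict bound on the spectral radius.
    rcases (spectrum ℂ a).eq_empty_or_nonempty with he | hne
    · simp [spectralRadius, he, hε]
    · refine spectrum.spectralRadius_lt_of_forall_lt_of_nonempty hne (r := ε.toNNReal) ?_
      intro w hw
      rw [← NNReal.coe_lt_coe, Real.coe_toNNReal _ hε.le]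
      exact h w hw
  obtain ⟨r, hr1, hr2⟩ := ENNReal.lt_iff_exists_nnreal_btwn.1 hlt
  have hr0 : 0 < r := by
    have := bot_le.trans_lt hr1
    simpa using this
  have hrε : (r : ℝ) < ε := by
    rw [← ENNReal.ofReal_coe_nnreal] at hr2
    exact (ENNReal.ofReal_lt_ofReal_iff hε).1 hr2
  have hev : ∀ᶠ m : ℕ in atTop, ‖a ^ m‖ ≤ (r : ℝ) ^ m := by
    filter_upwards [(spectrum.pow_nnnorm_pow_one_div_tendsto_nhds_spectralRadius a).eventually_lt_const
      hr1, eventually_gt_atTop 0] with m hm hm0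
    have h1 : (‖a ^ m‖₊ : ENNReal) < (r : ENNReal) ^ (m : ℝ) := by
      have := ENNReal.rpow_lt_rpow hm (z := (m : ℝ)) (by positivity)
      rwa [← ENNReal.rpow_mul, one_div_mul_cancel (by positivity), ENNReal.rpow_one] at this
    rw [ENNReal.rpow_natCast, ← ENNReal.coe_pow, ENNReal.coe_lt_coe] at h1
    exact_mod_cast h1.le
  have hO : (fun m : ℕ => ‖a ^ m‖) =O[atTop] fun m : ℕ => (r : ℝ) ^ m :=
    Asymptotics.IsBigO.of_bound 1 (by
      filter_upwards [hev] with m hm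
      simpa using hm)
  obtain ⟨K, -, hK⟩ := Asymptotics.bound_of_isBigO_nat_atTop hO
  refine ⟨r, K, by exact_mod_cast hr0, hrε, fun m => ?_⟩
  have := hK (x := m) (by positivity)
  simpa using this

/-- The resolvent vanishes at infinity, and what remains of the closed set of admissible `z` is
compact, where continuity gives a bound. -/
theorem exists_norm_resolvent_le (t : B) {δ : ℝ} (hδ : 0 < δ) :
    ∃ M : ℝ, ∀ z : ℂ, (∀ w ∈ spectrum ℂ t, δ ≤ dist z w) → ‖resolvent t z‖ ≤ M := by
  set F : Set ℂ := {z | ∀ w ∈ spectrum ℂ t, δ ≤ dist z w} with hF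
  have hFcl : IsClosed F := by
    have : F = ⋂ w ∈ spectrum ℂ t, {z | δ ≤ dist z w} := by ext; simp [hF]
    rw [this]
    exact isClosed_biInter fun w _ => isClosed_le continuous_const (by fun_prop)
  have hFsub : F ⊆ resolventSet ℂ t := fun z hz => by
    by_contra hzs
    have := hz z hzs
    rw [dist_self] at this
    linarith
  have hev : ∀ᶠ z in Bornology.cobounded ℂ, ‖resolvent t z‖ < 1 := by
    have := (spectrum.resolvent_tendsto_cobounded (𝕜 := ℂ) t).norm
    rw [norm_zero] at this
    exact this.eventually_lt_const one_pos
  obtain ⟨R, hR⟩ := (Metric.hasBasis_cobounded_compl_closedBall (0 : ℂ)).eventually_iff.1 hev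
  have hcpt : IsCompact (F ∩ Metric.closedBall 0 R) :=
    (isCompact_closedBall 0 R).inter_left hFcl
  have hcont : ContinuousOn (resolvent t) (F ∩ Metric.closedBall 0 R) := fun z hz =>
    (spectrum.hasDerivAt_resolvent_const_left (hFsub hz.1)).continuousAt.continuousWithinAt
  obtain ⟨M, hM⟩ := hcpt.exists_bound_of_continuousOn hcont
  refine ⟨max M 1, fun z hz => ?_⟩
  by_cases hzR : z ∈ Metric.closedBall (0 : ℂ) R
  · exact (hM z ⟨hz, hzR⟩).trans (le_max_left _ _)
  · exact (hR.2 hzR).le.trans (le_max_right _ _)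

theorem hasDerivAt_resolvent_pow (t : B) {z : ℂ} (hz : z ∈ resolventSet ℂ t) (k : ℕ) :
    HasDerivAt (fun w => resolvent t w ^ k) (-(k : ℂ) • resolvent t z ^ (k + 1)) z := by
  induction k with
  | zero => simpa using hasDerivAt_const z (1 : B)
  | succ k ih =>
    have h := ih.mul (spectrum.hasDerivAt_resolvent_const_left hz)
    simp only [pow_succ (resolvent t _) k]
    refine h.congr_deriv ?_
    push_cast
    rw [smul_mul_assoc, ← pow_succ, mul_neg, ← pow_add]
    module

theorem iteratedDeriv_resolvent (t : B) (m : ℕ) {z : ℂ} (hz : z ∈ resolventSet ℂ t) :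
    iteratedDeriv m (resolvent t) z =
      ((-1) ^ m * (m.factorial : ℂ)) • resolvent t z ^ (m + 1) := by
  induction m generalizing z with
  | zero => simp
  | succ m ih =>
    rw [iteratedDeriv_succ]
    have hev : iteratedDeriv m (resolvent t) =ᶠ[𝓝 z]
        fun w => ((-1) ^ m * (m.factorial : ℂ)) • resolvent t w ^ (m + 1) := by
      filter_upwards [(spectrum.isOpen_resolventSet t).mem_nhds hz] with w hw using ih hw
    have hd := (hasDerivAt_resolvent_pow t hz (m + 1)).const_smul ((-1) ^ m * (m.factorial : ℂ))
    rw [hev.deriv_eq]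
    refine hd.deriv.trans ?_
    rw [smul_smul,
      Nat.factorial_succ]
    congr 1
    push_cast
    ring

/-- Up to the factor `(-1)^m m!`, the power `R^(m+1)` is the `m`-th derivative of the resolvent.
Cauchy's estimate on the disc of radius `ρ` about `z`, which stays `d - ρ` away from the spectrum,
cancels the factorial. -/
theorem exists_norm_resolvent_pow_le (t : B) {ρ d : ℝ} (hρ : 0 < ρ) (hd : ρ < d) :
    ∃ M : ℝ, ∀ z : ℂ, (∀ w ∈ spectrum ℂ t, d ≤ dist z w) →
      ∀ m : ℕ, ‖resolvent t z ^ (m + 1)‖ ≤ M / ρ ^ m := by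
  obtain ⟨M, hM⟩ := exists_norm_resolvent_le t (sub_pos.2 hd)
  refine ⟨M, fun z hz m => ?_⟩
  have hball : ∀ x ∈ Metric.closedBall z ρ, ∀ w ∈ spectrum ℂ t, d - ρ ≤ dist x w := by
    intro x hx w hw
    have h1 := hz w hw
    have h2 := dist_triangle z x w
    rw [Metric.mem_closedBall'] at hx
    linarith
  have hres : ∀ x ∈ Metric.closedBall z ρ, x ∈ resolventSet ℂ t := fun x hx => by
    by_contra hxs
    have := hball x hx x hxs
    rw [dist_self] at this
    linarith
  have hdiff : DifferentiableOn ℂ (resolvent t) (Metric.closedBall z ρ) := fun x hx =>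
    (spectrum.hasDerivAt_resolvent_const_left (hres x hx)).differentiableAt.differentiableWithinAt
  have hcl : DiffContOnCl ℂ (resolvent t) (Metric.ball z ρ) :=
    DifferentiableOn.diffContOnCl (hdiff.mono Metric.closure_ball_subset_closedBall)
  have h := Complex.norm_iteratedDeriv_le_of_forall_mem_sphere_norm_le m hρ hcl
    fun x hx => hM x (hball x (Metric.sphere_subset_closedBall hx))
  rw [iteratedDeriv_resolvent t m (hres z (Metric.mem_closedBall_self hρ.le)), norm_smul] at h
  simp only [norm_mul, norm_pow, norm_neg, norm_one, one_pow, one_mul, Complex.norm_natCast,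
    mul_div_assoc] at h
  exact le_of_mul_le_mul_left h (by positivity)

theorem exists_hasSum_resolvent_add (t ν : B) (hc : Commute t ν) {ε d : ℝ} (hε : 0 < ε)
    (hd : ε < d) (hν : ∀ w ∈ spectrum ℂ ν, ‖w‖ < ε) :
    ∃ K q : ℝ, 0 ≤ q ∧ q < 1 ∧ ∀ z : ℂ, (∀ w ∈ spectrum ℂ t, d ≤ dist z w) →
      z ∈ resolventSet ℂ (t + ν) ∧
      HasSum (fun m => ν ^ m * resolvent t z ^ (m + 1)) (resolvent (t + ν) z) ∧
      ∀ m, ‖ν ^ m * resolvent t z ^ (m + 1)‖ ≤ K * q ^ m := by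
  obtain ⟨r, K, hr, hrε, hK⟩ := exists_norm_pow_le_of_spectrum_subset_ball ν hε hν
  -- The Cauchy radius is `ε` itself, so that the ratio `r / ε` is below `1`.
  obtain ⟨M, hM⟩ := exists_norm_resolvent_pow_le t hε hd
  refine ⟨K * M, r / ε, by positivity, (div_lt_one hε).2 hrε, fun z hz => ?_⟩
  have hb : ∀ m, ‖ν ^ m * resolvent t z ^ (m + 1)‖ ≤ K * M * (r / ε) ^ m := fun m => by
    calc _ ≤ ‖ν ^ m‖ * ‖resolvent t z ^ (m + 1)‖ := norm_mul_le _ _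
      _ ≤ (K * r ^ m) * (M / ε ^ m) :=
        mul_le_mul (hK m) (hM z hz m) (norm_nonneg _) ((norm_nonneg _).trans (hK m))
      _ = _ := by rw [div_pow]; ring
  have hzt : z ∈ resolventSet ℂ t := by
    by_contra hzs
    have := hz z hzs
    rw [dist_self] at this
    linarith
  set R := resolvent t z with hR
  obtain ⟨u, hu⟩ := hzt
  have hRu : R = ↑u⁻¹ := by rw [hR, resolvent, ← hu, Ring.inverse_unit]
  have huν : Commute (u : B) ν := by
    rw [hu]
    exact Commute.sub_left (Algebra.commutes z ν) hc
  have hRν : Commute R ν := hRu ▸ huν.units_inv_left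
  have hsum : Summable fun m => ν ^ m * R ^ (m + 1) :=
    Summable.of_norm_bounded
      ((summable_geometric_of_lt_one (by positivity) ((div_lt_one hε).2 hrε)).mul_left (K * M)) hb
  have hpow : ∀ m, ν ^ m * R ^ (m + 1) * u = (ν * R) ^ m := fun m => by
    rw [pow_succ, hRν.symm.mul_pow, mul_assoc, mul_assoc, hRu, Units.inv_mul, mul_one]
  have hpow' : ∀ m, (ν * R) ^ m * R = ν ^ m * R ^ (m + 1) := fun m => by
    rw [← hpow, mul_assoc, hRu, Units.mul_inv, mul_one]
  -- The Neumann series of `ν * R` converges although `‖ν * R‖ < 1` need not hold.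
  have hx : Summable fun m => (ν * R) ^ m := (hsum.mul_right (u : B)).congr hpow
  set G := ∑' m, (ν * R) ^ m
  have hG1 : G * (1 - ν * R) = 1 := hx.tsum_pow_mul_one_sub
  have hG2 : (1 - ν * R) * G = 1 := hx.one_sub_mul_tsum_pow
  have hfac : algebraMap ℂ B z - (t + ν) = (1 - ν * R) * u := by
    rw [sub_mul, one_mul, mul_assoc, hRu, Units.inv_mul, mul_one, hu, sub_sub]
  let g : Bˣ := ⟨1 - ν * R, G, hG2, hG1⟩
  have hfac' : algebraMap ℂ B z - (t + ν) = ((g * u : Bˣ) : B) := hfac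
  refine ⟨⟨g * u, hfac'.symm⟩, ?_, hb⟩
  have : resolvent (t + ν) z = G * R := by
    rw [resolvent, hfac', Ring.inverse_unit, mul_inv_rev, Units.val_mul, ← hRu]
    change R * G = G * R
    have hRx : Commute R (ν * R) := hRν.mul_right (Commute.refl R)
    exact ((hx.hasSum.mul_left R).congr_fun fun m => (hRx.pow_right m).eq.symm).unique
      (hx.hasSum.mul_right R)
  rw [this]
  exact (hx.hasSum.mul_right R).congr_fun fun m => (hpow' m).symm

end ComplexBanachAlgebra

/-! ### Complexification of a real Banach algebra and its left multiplications. -/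

noncomputable section Complexification

/-- The complexification of a real normed space `X`, realized as the space of bounded `ℝ`-linear
maps `ℂ → X`, on which `ℂ` acts by multiplication in the argument. -/
def Complexified (X : Type*) [NormedAddCommGroup X] [NormedSpace ℝ X] : Type _ := ℂ →L[ℝ] X

namespace Complexified

variable {X : Type*} [NormedAddCommGroup X] [NormedSpace ℝ X]

instance : NormedAddCommGroup (Complexified X) := inferInstanceAs (NormedAddCommGroup (ℂ →L[ℝ] X))

instance [CompleteSpace X] : CompleteSpace (Complexified X) :=
  inferInstanceAs (CompleteSpace (ℂ →L[ℝ] X))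

instance : FunLike (Complexified X) ℂ X := inferInstanceAs (FunLike (ℂ →L[ℝ] X) ℂ X)

/-- A bounded `ℝ`-linear map `ℂ → X` as an element of the complexification. -/
def of (f : ℂ →L[ℝ] X) : Complexified X := f

@[simp] theorem of_apply (f : ℂ →L[ℝ] X) (w : ℂ) : of f w = f w := rfl

@[ext] theorem ext {f g : Complexified X} (h : ∀ w, f w = g w) : f = g :=
  ContinuousLinearMap.ext h

@[simp] theorem add_apply (f g : Complexified X) (w : ℂ) : (f + g) w = f w + g w := rfl

@[simp] theorem zero_apply (w : ℂ) : (0 : Complexified X) w = 0 := rfl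

instance : SMul ℂ (Complexified X) where
  smul z f := of (ContinuousLinearMap.comp (f : ℂ →L[ℝ] X) (ContinuousLinearMap.mul ℝ ℂ z))

@[simp] theorem smul_apply (z : ℂ) (f : Complexified X) (w : ℂ) : (z • f) w = f (z * w) := rfl

theorem apply_add (f : Complexified X) (v w : ℂ) : f (v + w) = f v + f w :=
  ContinuousLinearMap.map_add (f : ℂ →L[ℝ] X) v w

theorem apply_zero (f : Complexified X) : f 0 = 0 := ContinuousLinearMap.map_zero (f : ℂ →L[ℝ] X)

theorem apply_real_smul (f : Complexified X) (r : ℝ) (w : ℂ) : f (r • w) = r • f w :=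
  ContinuousLinearMap.map_smul (f : ℂ →L[ℝ] X) r w

theorem norm_apply_le (f : Complexified X) (w : ℂ) : ‖f w‖ ≤ ‖f‖ * ‖w‖ :=
  ContinuousLinearMap.le_opNorm (f : ℂ →L[ℝ] X) w

instance : NormedSpace ℂ (Complexified X) where
  one_smul f := by ext w; simp
  mul_smul y z f := by
    ext w
    simp only [smul_apply]
    congr 1
    ring
  smul_zero z := by ext w; simp
  smul_add z f g := by ext w; simp
  add_smul y z f := by ext w; simp [add_mul, apply_add]
  zero_smul f := by ext w; simp [apply_zero]
  norm_smul_le z f := by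
    refine ContinuousLinearMap.opNorm_le_bound (_ : ℂ →L[ℝ] X) (by positivity) fun w => ?_
    refine (norm_apply_le f (z * w)).trans (le_of_eq ?_)
    rw [norm_mul]
    ring

/-- The inclusion of `X` as the real part of its complexification. -/
def ofReal (x : X) : Complexified X := of (Complex.reCLM.smulRight x)

@[simp] theorem ofReal_apply (x : X) (w : ℂ) : ofReal x w = w.re • x := rfl

variable {A : Type*} [NormedRing A] [NormedAlgebra ℝ A]

/-- Left multiplication by `a`, extended to the complexification. -/
def mulLeft (a : A) : Complexified A →L[ℂ] Complexified A :=
  LinearMap.mkContinuous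
    { toFun := fun f => of (ContinuousLinearMap.comp (ContinuousLinearMap.mul ℝ A a) (f : ℂ →L[ℝ] A))
      map_add' := fun f g => by ext w; exact mul_add a (f w) (g w)
      map_smul' := fun z f => rfl } ‖a‖ fun f => by
    refine ContinuousLinearMap.opNorm_le_bound (_ : ℂ →L[ℝ] A) (by positivity) fun w => ?_
    refine (norm_mul_le a (f w)).trans ?_
    rw [mul_assoc]
    exact mul_le_mul_of_nonneg_left (norm_apply_le f w) (norm_nonneg a)

@[simp] theorem mulLeft_apply (a : A) (f : Complexified A) (w : ℂ) : mulLeft a f w = a * f w := rfl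

variable (A) in
/-- Left multiplication as a ring homomorphism into the bounded operators on the
complexification. -/
def mulLeftHom : A →+* (Complexified A →L[ℂ] Complexified A) where
  toFun := mulLeft
  map_one' := by ext f w; simp
  map_mul' a b := by ext f w; simp [mul_assoc]
  map_zero' := by ext f w; simp
  map_add' a b := by ext f w; simp [add_mul]

@[simp] theorem mulLeftHom_apply (a : A) (f : Complexified A) (w : ℂ) :
    mulLeftHom A a f w = a * f w := rfl

theorem mulLeftHom_algebraMap (r : ℝ) :
    mulLeftHom A (algebraMap ℝ A r) =
      algebraMap ℂ (Complexified A →L[ℂ] Complexified A) r := by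
  ext f w
  rw [mulLeftHom_apply, Algebra.algebraMap_eq_smul_one, Algebra.algebraMap_eq_smul_one]
  change _ = f (r * w)
  rw [← Complex.real_smul, apply_real_smul, smul_one_mul]

/-- Surjectivity of the multiplication gives a right inverse `b`. Injectivity applied to `a (b a -
1) = 0` makes it two-sided. -/
theorem isUnit_of_isUnit_mulLeftHom {a : A} (h : IsUnit (mulLeftHom A a)) : IsUnit a := by
  obtain ⟨u, hu⟩ := h
  have hinj : ∀ b : A, a * b = 0 → b = 0 := fun b hb => by
    have h0 : mulLeftHom A a (ofReal b) = 0 := by ext w; simp [hb]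
    have h1 : ofReal b = 0 := by
      have := congrArg (u⁻¹).val h0
      rw [← hu, map_zero] at this
      rw [← this]
      change _ = (u⁻¹.val * u.val) (ofReal b)
      rw [Units.inv_mul]
      rfl
    simpa using congrArg (fun f : Complexified A => f 1) h1
  have hab : a * ((u⁻¹).val (ofReal 1)) 1 = 1 := by
    have h1 : (u.val * u⁻¹.val) (ofReal (1 : A)) = ofReal 1 := by rw [Units.mul_inv]; rfl
    have h2 := congrArg (fun f : Complexified A => f 1) h1
    rw [hu] at h2
    simpa using h2
  set b := ((u⁻¹).val (ofReal 1)) 1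
  refine ⟨⟨a, b, hab, ?_⟩, rfl⟩
  have := hinj (b * a - 1) (by rw [mul_sub, ← mul_assoc, hab]; simp)
  exact sub_eq_zero.1 this

/-- Evaluation of an element of the complexification, where the imaginary unit is replaced by the
right multiplication with `j`. -/
def eval (j : A) (f : Complexified A) : A := f 1 - f Complex.I * j

variable {j : A}

theorem eval_mulLeftHom (a : A) (f : Complexified A) :
    eval j (mulLeftHom A a f) = a * eval j f := by
  simp [eval, mul_sub, mul_assoc]

theorem eval_add (f g : Complexified A) : eval j (f + g) = eval j f + eval j g := by
  simp only [eval, add_apply, add_mul]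
  abel

theorem eval_ofReal (a : A) : eval j (ofReal a) = a := by simp [eval]

theorem apply_eq (f : Complexified A) (w : ℂ) : f w = w.re • f 1 + w.im • f Complex.I := by
  rw [← apply_real_smul, ← apply_real_smul, ← apply_add]
  congr 1
  apply Complex.ext <;> simp

/-- Scalars act in the argument, so the imaginary part of `f` is `-f I`; hence the minus sign in
`eval`. As `j² = -1`, multiplication by `z` becomes right multiplication by `z.re + z.im j`, which
commutes with left multiplications. -/
theorem eval_smul (hj : j * j = -1) (z : ℂ) (f : Complexified A) :
    eval j (z • f) = eval j f * (z.re • 1 + z.im • j) := by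
  simp only [eval, smul_apply]
  rw [apply_eq f (z * 1), apply_eq f (z * Complex.I)]
  simp only [mul_one, Complex.mul_re, Complex.I_re, Complex.mul_im, Complex.I_im, mul_zero,
    zero_sub, sub_mul, neg_mul, add_mul, mul_add, mul_smul_comm, smul_mul_assoc, mul_assoc, hj,
    mul_neg, neg_smul, add_zero]
  module

theorem norm_eval_le (j : A) (f : Complexified A) : ‖eval j f‖ ≤ (1 + ‖j‖) * ‖f‖ := by
  have h1 := norm_apply_le f 1
  have h2 := norm_apply_le f Complex.I
  rw [norm_one, mul_one] at h1
  rw [Complex.norm_I, mul_one] at h2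
  calc ‖f 1 - f Complex.I * j‖ ≤ ‖f 1‖ + ‖f Complex.I * j‖ := norm_sub_le _ _
    _ ≤ ‖f‖ + ‖f‖ * ‖j‖ := add_le_add h1 ((norm_mul_le _ _).trans (by gcongr))
    _ = _ := by ring

/-- The value of a bounded operator on the complexification at `1`, evaluated at `j`. -/
def evalOne (j : A) : (Complexified A →L[ℂ] Complexified A) →+ A where
  toFun u := eval j (u (ofReal 1))
  map_zero' := by simp [eval]
  map_add' u v := eval_add _ _

theorem norm_evalOne_le (j : A) (u : Complexified A →L[ℂ] Complexified A) :
    ‖evalOne j u‖ ≤ (1 + ‖j‖) * ‖ofReal (1 : A)‖ * ‖u‖ := by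
  refine (norm_eval_le j _).trans ?_
  rw [mul_assoc]
  gcongr
  rw [mul_comm]
  exact u.le_opNorm _

theorem continuous_evalOne (j : A) : Continuous (evalOne j) :=
  AddMonoidHomClass.continuous_of_bound (evalOne j) _ (norm_evalOne_le j)

end Complexified

end Complexification

/-! ### Transfer of the resolvent series to real Banach algebras. -/

noncomputable section RealBanachAlgebra

variable {A : Type*} [NormedRing A] [NormedAlgebra ℝ A]

/-- The real quadratic polynomial with roots `z` and `conj z`, evaluated at `a`. -/
def quadAt (z : ℂ) (a : A) : A := a ^ 2 - (2 * z.re) • a + ‖z‖ ^ 2 • (1 : A)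

theorem quadAt_conj (z : ℂ) (a : A) : quadAt (starRingEnd ℂ z) a = quadAt z a := by
  simp [quadAt]

namespace Complexified

theorem mulLeftHom_quadAt (z : ℂ) (a : A) :
    mulLeftHom A (quadAt z a) = (algebraMap ℂ _ z - mulLeftHom A a) *
      (algebraMap ℂ _ (starRingEnd ℂ z) - mulLeftHom A a) := by
  rw [quadAt, ← Algebra.algebraMap_eq_smul_one, Algebra.smul_def, map_add, map_sub, map_mul,
    map_pow, mulLeftHom_algebraMap, mulLeftHom_algebraMap, sub_mul, mul_sub, mul_sub,
    ← map_mul (algebraMap ℂ _), Complex.mul_conj, Complex.normSq_eq_norm_sq,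
    ← Algebra.commutes (starRingEnd ℂ z) (mulLeftHom A a),
    show ((2 * z.re : ℝ) : ℂ) = z + starRingEnd ℂ z by
      rw [Complex.add_conj], map_add (algebraMap ℂ _), sq]
  noncomm_ring

theorem mem_resolventSet_mulLeftHom {z : ℂ} {a : A} (h : IsUnit (quadAt z a)) :
    z ∈ resolventSet ℂ (mulLeftHom A a) ∧
      resolvent (mulLeftHom A a) z = mulLeftHom A (Ring.inverse (quadAt z a)) *
        (algebraMap ℂ _ (starRingEnd ℂ z) - mulLeftHom A a) := by
  set x := algebraMap ℂ (Complexified A →L[ℂ] Complexified A) z - mulLeftHom A a with hx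
  set y := algebraMap ℂ (Complexified A →L[ℂ] Complexified A) (starRingEnd ℂ z) - mulLeftHom A a
    with hy
  have hxy : mulLeftHom A (quadAt z a) = x * y := mulLeftHom_quadAt z a
  have hyx : mulLeftHom A (quadAt z a) = y * x := by
    rw [← quadAt_conj, mulLeftHom_quadAt, Complex.conj_conj]
  set p := mulLeftHom A (Ring.inverse (quadAt z a)) with hp
  have h1 : p * (y * x) = 1 := by
    rw [← hyx, hp, ← map_mul, Ring.inverse_mul_cancel _ h, map_one]
  have h2 : x * y * p = 1 := by
    rw [← hxy, hp, ← map_mul, Ring.mul_inverse_cancel _ h, map_one]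
  have h3 : p * y * x = 1 := by rw [mul_assoc, h1]
  have h4 : x * (p * y) = 1 := by
    -- A left and a right inverse of `x` coincide.
    have : p * y = y * p := by
      calc p * y = p * y * (x * y * p) := by rw [h2, mul_one]
        _ = (p * y * x) * (y * p) := by noncomm_ring
        _ = y * p := by rw [h3, one_mul]
    rw [this, ← mul_assoc, h2]
  let u : (Complexified A →L[ℂ] Complexified A)ˣ := ⟨x, p * y, h4, h3⟩
  have hu : x = u := rfl
  refine ⟨⟨u, rfl⟩, ?_⟩
  rw [resolvent, ← hx, hu, Ring.inverse_unit]
  rfl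

theorem spectrum_mulLeftHom {z : ℂ} {a : A} (h : z ∈ spectrum ℂ (mulLeftHom A a)) :
    ¬ IsUnit (quadAt z a) := fun hu => h (mem_resolventSet_mulLeftHom hu).1

variable {j : A}

theorem evalOne_mulLeftHom_mul (a : A) (u : Complexified A →L[ℂ] Complexified A) :
    evalOne j (mulLeftHom A a * u) = a * evalOne j u := eval_mulLeftHom a _

theorem evalOne_algebraMap_mul (hj : j * j = -1) (z : ℂ)
    (u : Complexified A →L[ℂ] Complexified A) :
    evalOne j (algebraMap ℂ _ z * u) = evalOne j u * (z.re • 1 + z.im • j) := eval_smul hj z _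

theorem evalOne_one : evalOne j 1 = 1 := eval_ofReal 1

/-- This is the recursion satisfied by the S-resolvent powers: each resolvent factor multiplies by
the conjugate scalar on the right, subtracts `a` times the value, and applies the inverse quadratic
on the left. -/
theorem evalOne_resolvent_mul (hj : j * j = -1) {z : ℂ} {a : A} (h : IsUnit (quadAt z a))
    (u : Complexified A →L[ℂ] Complexified A) :
    evalOne j (resolvent (mulLeftHom A a) z * u) = Ring.inverse (quadAt z a) *
      (evalOne j u * (z.re • 1 - z.im • j) - a * evalOne j u) := by
  rw [(mem_resolventSet_mulLeftHom h).2, mul_assoc, evalOne_mulLeftHom_mul, sub_mul, map_sub,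
    evalOne_algebraMap_mul hj, evalOne_mulLeftHom_mul, Complex.conj_re, Complex.conj_im, neg_smul,
    ← sub_eq_add_neg]

end Complexified

open Complexified

/-- If `U m` is the `m`-th power of the resolvent of the left multiplication by `T` at the right
multiplication by `s = z.re + z.im j`, applied to `1`, then the terms `N ^ m * U (m + 1)` sum up
to the resolvent of the left multiplication by `T + N`, applied to `1`. -/
theorem exists_hasSum_pow_mul [CompleteSpace A] (T N : A) (hTN : Commute T N) {ε d : ℝ}
    (hε : 0 < ε) (hd : ε < d) (hN : ∀ w : ℂ, ¬ IsUnit (quadAt w N) → ‖w‖ < ε) :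
    ∃ K q : ℝ, 0 ≤ q ∧ q < 1 ∧ ∀ z : ℂ, (∀ w : ℂ, ¬ IsUnit (quadAt w T) → d ≤ dist z w) →
      IsUnit (quadAt z (T + N)) ∧
      ∀ j : A, j * j = -1 → ∀ U : ℕ → A, U 0 = 1 →
        (∀ m, U (m + 1) =
          Ring.inverse (quadAt z T) * (U m * (z.re • 1 - z.im • j) - T * U m)) →
        HasSum (fun m => N ^ m * U (m + 1))
          (Ring.inverse (quadAt z (T + N)) * ((z.re • 1 - z.im • j) - (T + N))) ∧
        ∀ m, ‖N ^ m * U (m + 1)‖ ≤ (1 + ‖j‖) * K * q ^ m := by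
  set t := mulLeftHom A T with ht
  set ν := mulLeftHom A N with hν
  have hc : Commute t ν := hTN.map (mulLeftHom A)
  obtain ⟨K, q, hq0, hq1, h⟩ := exists_hasSum_resolvent_add t ν hc hε hd
    fun w hw => hN w (spectrum_mulLeftHom hw)
  refine ⟨‖ofReal (1 : A)‖ * K, q, hq0, hq1, fun z hz => ?_⟩
  -- Invertibility of `quadAt z (T + N)` needs both of its linear factors, hence also the conjugate
  -- point; the set of `w` is symmetric under conjugation.
  have hz' : ∀ w : ℂ, ¬ IsUnit (quadAt w T) → d ≤ dist (starRingEnd ℂ z) w := fun w hw => by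
    have := hz (starRingEnd ℂ w) (by rwa [quadAt_conj])
    rwa [← Complex.dist_conj_conj, Complex.conj_conj]
  obtain ⟨hz1, hz2, hz3⟩ := h z fun w hw => hz w (spectrum_mulLeftHom hw)
  obtain ⟨hz1', -, -⟩ := h (starRingEnd ℂ z) fun w hw => hz' w (spectrum_mulLeftHom hw)
  have hT : IsUnit (quadAt z T) := by
    by_contra hn
    have := hz z hn
    rw [dist_self] at this
    linarith
  have hTN' : IsUnit (quadAt z (T + N)) := by
    apply isUnit_of_isUnit_mulLeftHom
    rw [mulLeftHom_quadAt, map_add]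
    exact hz1.mul hz1'
  refine ⟨hTN', fun j hj U hU0 hU => ?_⟩
  have hUeq : ∀ m, U m = evalOne j (resolvent t z ^ m) := by
    intro m
    induction m with
    | zero => rw [hU0, pow_zero, evalOne_one]
    | succ m ih => rw [hU, ih, pow_succ', evalOne_resolvent_mul hj hT]
  have hterm : ∀ m, N ^ m * U (m + 1) = evalOne j (ν ^ m * resolvent t z ^ (m + 1)) := fun m => by
    rw [hν, ← map_pow, evalOne_mulLeftHom_mul, hUeq]
  have hlim : evalOne j (resolvent (t + ν) z) =
      Ring.inverse (quadAt z (T + N)) * ((z.re • 1 - z.im • j) - (T + N)) := by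
    rw [← mul_one (resolvent (t + ν) z), ht, hν, ← map_add, evalOne_resolvent_mul hj hTN',
      evalOne_one, one_mul, mul_one]
  constructor
  · rw [← hlim]
    exact (hz2.map (evalOne j) (continuous_evalOne j)).congr_fun hterm
  · intro m
    rw [hterm, mul_assoc (1 + ‖j‖), mul_assoc ‖ofReal (1 : A)‖, ← mul_assoc]
    exact (norm_evalOne_le j _).trans (by gcongr; exact hz3 m)

end RealBanachAlgebra

/-! ### Complex planes in the space of paravectors. -/

noncomputable section SliceCalculus

namespace SCalc

section Planes

variable {n : ℕ}

/-- The paravector `w.re + w.im J` in the plane spanned by `1` and `J`. -/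
def Paravector.ofComplex (J : Fin n → ℝ) (w : ℂ) : Paravector n :=
  WithLp.toLp 2 (Fin.cons w.re fun k => w.im * J k)

open Paravector

@[simp] theorem ofComplex_zero (J : Fin n → ℝ) (w : ℂ) : ofComplex J w 0 = w.re := rfl

@[simp] theorem ofComplex_succ (J : Fin n → ℝ) (w : ℂ) (k : Fin n) :
    ofComplex J w k.succ = w.im * J k := rfl

theorem norm_ofComplex {J : Fin n → ℝ} (hJ : ∑ k, J k ^ 2 = 1) (w : ℂ) :
    ‖ofComplex J w‖ = ‖w‖ := by
  rw [← sq_eq_sq₀ (norm_nonneg _) (norm_nonneg _), EuclideanSpace.norm_sq_eq, Fin.sum_univ_succ,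
    ← Complex.normSq_eq_norm_sq, Complex.normSq_apply]
  simp only [ofComplex_zero, ofComplex_succ, Real.norm_eq_abs, sq_abs, mul_pow]
  rw [← Finset.mul_sum, hJ]
  ring

theorem ofComplex_sub (J : Fin n → ℝ) (z w : ℂ) :
    ofComplex J z - ofComplex J w = ofComplex J (z - w) := by
  ext k
  refine Fin.cases ?_ (fun k => ?_) k
  · simp
  · simp [sub_mul]

theorem dist_ofComplex {J : Fin n → ℝ} (hJ : ∑ k, J k ^ 2 = 1) (z w : ℂ) :
    dist (ofComplex J z) (ofComplex J w) = dist z w := by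
  rw [dist_eq_norm, ofComplex_sub, norm_ofComplex hJ, dist_eq_norm]

/-- `J` is the normalized vector part of `s`. If that part vanishes, any unit vector serves, and one
exists because `n ≥ 1`. -/
theorem exists_eq_ofComplex (hn : 1 ≤ n) (s : Paravector n) :
    ∃ (J : Fin n → ℝ) (z : ℂ), ∑ k, J k ^ 2 = 1 ∧ s = ofComplex J z := by
  set v : ℝ := √(∑ k : Fin n, s k.succ ^ 2) with hv
  have hnn : 0 ≤ ∑ k : Fin n, s k.succ ^ 2 := Finset.sum_nonneg fun k _ => sq_nonneg _
  have hv2 : v ^ 2 = ∑ k : Fin n, s k.succ ^ 2 := Real.sq_sqrt hnn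
  by_cases h0 : v = 0
  · refine ⟨Pi.single ⟨0, hn⟩ 1, s 0, ?_, ?_⟩
    · rw [Finset.sum_eq_single ⟨0, hn⟩ (fun k _ hk => by simp [hk]) (by simp)]
      simp
    · ext k
      refine Fin.cases ?_ (fun k => ?_) k
      · simp
      · rw [h0, zero_pow two_ne_zero] at hv2
        have := (Finset.sum_eq_zero_iff_of_nonneg fun k _ => sq_nonneg _).1 hv2.symm k
          (Finset.mem_univ k)
        simpa using this
  · refine ⟨fun k => s k.succ / v, ⟨s 0, v⟩, ?_, ?_⟩
    · simp only [div_pow]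
      rw [← Finset.sum_div, ← hv2, div_self (pow_ne_zero 2 h0)]
    · ext k
      refine Fin.cases ?_ (fun k => ?_) k
      · simp
      · simp [mul_div_cancel₀ _ h0]

theorem exists_lt_le_dist_of_lt_setDist {C S : Set (Paravector n)} {ε : ℝ}
    (h : ENNReal.ofReal ε < setDist C S) : ∃ d : ℝ, ε < d ∧ ∀ x ∈ C, ∀ y ∈ S, d ≤ dist x y := by
  obtain ⟨d, hd1, hd2⟩ := ENNReal.lt_iff_exists_nnreal_btwn.1 h
  refine ⟨d, ?_, fun x hx y hy => ?_⟩
  · by_contra hle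
    have := ENNReal.ofReal_le_ofReal (not_lt.1 hle)
    rw [ENNReal.ofReal_coe_nnreal] at this
    exact absurd hd1 this.not_gt
  · have h1 : (d : ENNReal) ≤ edist x y :=
      hd2.le.trans ((iInf₂_le x hx).trans (iInf₂_le y hy))
    rw [edist_nndist, ENNReal.coe_le_coe] at h1
    exact_mod_cast h1

end Planes

/-! ### S-resolvent powers, their recursions and their series. -/

section Operators

variable {n : ℕ} {V : Type*} [NormedAddCommGroup V] [NormedSpace ℝ V]

open Paravector

instance [CompleteSpace V] : CompleteSpace (Vn n V) :=
  inferInstanceAs (CompleteSpace (PiLp 2 fun _ : Finset (Fin n) => V))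

theorem quadOp_ofComplex {J : Fin n → ℝ} (hJ : ∑ k, J k ^ 2 = 1) (z : ℂ) (T : BVn n V) :
    quadOp (ofComplex J z) T = quadAt z T := by
  rw [quadOp, norm_ofComplex hJ, quadAt, ofComplex_zero]

theorem ofComplex_mem_sSpectrum {J : Fin n → ℝ} (hJ : ∑ k, J k ^ 2 = 1) {z : ℂ} {T : BVn n V} :
    ofComplex J z ∈ sSpectrum T ↔ ¬ IsUnit (quadAt z T) := by
  rw [← quadOp_ofComplex hJ]
  rfl

variable (V) in
/-- The scalar operator of the vector `J`. -/
def vectorOp (J : Fin n → ℝ) : BVn n V := ∑ k, J k • unitOp V k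

theorem vectorOp_mul_self {J : Fin n → ℝ} (hJ : ∑ k, J k ^ 2 = 1) :
    vectorOp V J * vectorOp V J = -1 := by
  have h := linearCombination_sq (unitOp V) unitOp_mul_self (fun _ _ => unitOp_mul_add_mul) J
  rw [Fintype.linearCombination_apply, QuadraticMap.weightedSumSquares_apply] at h
  refine h.trans ?_
  have : ∑ i, (-1 : ℝ) • (J i * J i) = -1 := by
    simp only [neg_smul, one_smul, Finset.sum_neg_distrib, ← sq, hJ]
  rw [this, map_neg, map_one]

/-- The bound does not depend on `J`, which makes the estimates uniform over all planes. -/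
theorem norm_vectorOp_le {J : Fin n → ℝ} (hJ : ∑ k, J k ^ 2 = 1) :
    ‖vectorOp V J‖ ≤ ∑ k : Fin n, ‖unitOp V k‖ := by
  refine norm_sum_le_of_le _ fun k _ => ?_
  have h1 : J k ^ 2 ≤ 1 :=
    hJ ▸ Finset.single_le_sum (fun i _ => sq_nonneg (J i)) (Finset.mem_univ k)
  rw [norm_smul, Real.norm_eq_abs]
  exact mul_le_of_le_one_left (norm_nonneg _) ((sq_le_one_iff_abs_le_one _).1 h1)

theorem scalarOp_conj_ofComplex (J : Fin n → ℝ) (z : ℂ) :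
    scalarOp n V (ofComplex J z).conj.toCl = z.re • 1 - z.im • vectorOp V J := by
  have h0 : (ofComplex J z).conj 0 = z.re := rfl
  have hs : ∀ k : Fin n, (ofComplex J z).conj k.succ = -(z.im * J k) := fun k => rfl
  rw [toCl, h0, map_add, AlgHom.commutes, Algebra.algebraMap_eq_smul_one, map_sum, vectorOp,
    Finset.smul_sum, sub_eq_add_neg, ← Finset.sum_neg_distrib]
  congr 1
  refine Finset.sum_congr rfl fun k _ => ?_
  rw [hs, map_smul, scalarOp_imUnit, neg_smul, mul_smul]

theorem commute_inverse_quadOp (s : Paravector n) (T : BVn n V) :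
    Commute (Ring.inverse (quadOp s T)) T := by
  by_cases hu : IsUnit (quadOp s T)
  · have h : Commute (T ^ 2) T := (Commute.refl T).pow_left 2
    have hc : Commute (quadOp s T) T :=
      (h.sub_left ((Commute.refl T).smul_left _)).add_left ((Commute.one_left T).smul_left _)
    obtain ⟨u, hu⟩ := hu
    rw [← hu] at hc ⊢
    rw [Ring.inverse_unit]
    exact hc.units_inv_left
  · rw [Ring.inverse_non_unit _ hu]
    exact Commute.zero_left T

theorem leftEval_add (T : BVn n V) (p q : Polynomial (Cl n)) :
    leftEval T (p + q) = leftEval T p + leftEval T q :=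
  Polynomial.sum_add_index p q _ (fun _ => by simp) fun _ _ _ => by rw [map_add, mul_add]

theorem leftEval_monomial (T : BVn n V) (k : ℕ) (a : Cl n) :
    leftEval T (Polynomial.monomial k a) = T ^ k * scalarOp n V a :=
  Polynomial.sum_monomial_index a _ (by simp)

/-- Coefficients stand to the right of the powers of `T`: the constant `c` multiplies on the right,
while the central indeterminate adds a factor `T` on the left. -/
theorem leftEval_mul_sub (T : BVn n V) (p : Polynomial (Cl n)) (c : Cl n) :
    leftEval T (p * (Polynomial.C c - Polynomial.X)) =
      leftEval T p * scalarOp n V c - T * leftEval T p := by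
  induction p using Polynomial.induction_on' with
  | add p q hp hq =>
    rw [add_mul, leftEval_add, hp, hq, leftEval_add]
    noncomm_ring
  | monomial k a =>
    have h : Polynomial.monomial k a * (Polynomial.C c - Polynomial.X) =
        Polynomial.monomial k (a * c) + Polynomial.monomial (k + 1) (-a) := by
      rw [mul_sub, Polynomial.monomial_mul_C, Polynomial.monomial_mul_X, map_neg, sub_eq_add_neg]
    rw [h, leftEval_add, leftEval_monomial, leftEval_monomial, leftEval_monomial, map_mul, map_neg,
      pow_succ']
    noncomm_ring

theorem rightEval_add (T : BVn n V) (p q : Polynomial (Cl n)) :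
    rightEval T (p + q) = rightEval T p + rightEval T q :=
  Polynomial.sum_add_index p q _ (fun _ => by simp) fun _ _ _ => by rw [map_add, add_mul]

theorem rightEval_monomial (T : BVn n V) (k : ℕ) (a : Cl n) :
    rightEval T (Polynomial.monomial k a) = scalarOp n V a * T ^ k :=
  Polynomial.sum_monomial_index a _ (by simp)

theorem rightEval_sub_mul (T : BVn n V) (p : Polynomial (Cl n)) (c : Cl n) :
    rightEval T ((Polynomial.C c - Polynomial.X) * p) =
      scalarOp n V c * rightEval T p - rightEval T p * T := by
  induction p using Polynomial.induction_on' with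
  | add p q hp hq =>
    rw [mul_add, rightEval_add, hp, hq, rightEval_add]
    noncomm_ring
  | monomial k a =>
    have h : (Polynomial.C c - Polynomial.X) * Polynomial.monomial k a =
        Polynomial.monomial k (c * a) + Polynomial.monomial (k + 1) (-a) := by
      rw [sub_mul, Polynomial.C_mul_monomial, Polynomial.X_mul_monomial, map_neg, sub_eq_add_neg]
    rw [h, rightEval_add, rightEval_monomial, rightEval_monomial, rightEval_monomial, map_mul,
      map_neg, pow_succ]
    noncomm_ring

theorem leftResolventPow_zero (s : Paravector n) (T : BVn n V) : leftResolventPow 0 s T = 1 := by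
  have h := leftEval_monomial T 0 1
  rw [Polynomial.monomial_zero_one] at h
  rw [leftResolventPow, starPow, pow_zero, pow_zero, h, pow_zero, map_one, one_mul, one_mul]

theorem leftResolventPow_succ (m : ℕ) (s : Paravector n) (T : BVn n V) :
    leftResolventPow (m + 1) s T = Ring.inverse (quadOp s T) *
      (leftResolventPow m s T * scalarOp n V s.conj.toCl - T * leftResolventPow m s T) := by
  rw [leftResolventPow, leftResolventPow, starPow, starPow, pow_succ (Polynomial.C _ - _),
    leftEval_mul_sub, ← mul_assoc T, ← ((commute_inverse_quadOp s T).pow_left m).eq, pow_succ']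
  noncomm_ring

theorem rightResolventPow_zero (s : Paravector n) (T : BVn n V) :
    rightResolventPow 0 s T = 1 := by
  have h := rightEval_monomial T 0 1
  rw [Polynomial.monomial_zero_one] at h
  rw [rightResolventPow, starPow, pow_zero, pow_zero, h, pow_zero, map_one, one_mul, one_mul]

theorem rightResolventPow_succ (m : ℕ) (s : Paravector n) (T : BVn n V) :
    rightResolventPow (m + 1) s T =
      (scalarOp n V s.conj.toCl * rightResolventPow m s T - rightResolventPow m s T * T) *
        Ring.inverse (quadOp s T) := by
  rw [rightResolventPow, rightResolventPow, starPow, starPow, pow_succ' (Polynomial.C _ - _),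
    rightEval_sub_mul, mul_assoc _ _ T, ((commute_inverse_quadOp s T).pow_left m).eq, pow_succ]
  noncomm_ring

theorem inverse_op {R : Type*} [MonoidWithZero R] (x : R) :
    Ring.inverse (MulOpposite.op x) = MulOpposite.op (Ring.inverse x) := by
  by_cases h : IsUnit x
  · obtain ⟨u, rfl⟩ := h
    rw [Ring.inverse_unit]
    exact Ring.inverse_unit (Units.opEquiv.symm (MulOpposite.op u))
  · rw [Ring.inverse_non_unit _ h, Ring.inverse_non_unit _ (by rwa [isUnit_op])]
    rfl

theorem quadAt_op {A : Type*} [NormedRing A] [NormedAlgebra ℝ A] (z : ℂ) (a : A) :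
    quadAt z (MulOpposite.op a) = MulOpposite.op (quadAt z a) := by simp [quadAt]

theorem norm_lt_of_sSpectrum_subset_ball {N : BVn n V} {ε : ℝ} (hn : 1 ≤ n)
    (hNε : sSpectrum N ⊆ Metric.ball 0 ε) (w : ℂ) (hw : ¬ IsUnit (quadAt w N)) : ‖w‖ < ε := by
  -- Any plane will do, so the point `0` only supplies some unit vector `J`.
  obtain ⟨J, -, hJ, -⟩ := exists_eq_ofComplex hn (0 : Paravector n)
  have := hNε ((ofComplex_mem_sSpectrum hJ).2 hw)
  rwa [mem_ball_zero_iff, norm_ofComplex hJ] at this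

variable [CompleteSpace V] {T N : BVn n V} {ε : ℝ} {C : Set (Paravector n)}

/-- The sign of `K` is not known, hence the absolute value. -/
theorem one_add_mul_mul_le {x c K b : ℝ} (hx : x ≤ c) (hx0 : 0 ≤ x) (hb : 0 ≤ b) :
    (1 + x) * K * b ≤ (1 + c) * |K| * b := by
  calc (1 + x) * K * b ≤ (1 + x) * |K| * b := by gcongr; exact le_abs_self K
    _ ≤ _ := by gcongr

theorem exists_hasSum_leftResolvent (hn : 1 ≤ n) (hTN : T * N = N * T) (hε : 0 < ε)
    (hNε : sSpectrum N ⊆ Metric.ball 0 ε) (hC : ENNReal.ofReal ε < setDist C (sSpectrum T)) :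
    ∃ K q : ℝ, 0 ≤ q ∧ q < 1 ∧ ∀ s ∈ C, s ∈ sResolventSet (T + N) ∧
      HasSum (fun m : ℕ => N ^ m * leftResolventPow (m + 1) s T) (leftResolvent s (T + N)) ∧
      ∀ m, ‖N ^ m * leftResolventPow (m + 1) s T‖ ≤ K * q ^ m := by
  obtain ⟨d, hd, hdist⟩ := exists_lt_le_dist_of_lt_setDist hC
  obtain ⟨K, q, hq0, hq1, h⟩ := exists_hasSum_pow_mul T N hTN hε hd
    (norm_lt_of_sSpectrum_subset_ball hn hNε)
  refine ⟨(1 + ∑ k : Fin n, ‖unitOp V k‖) * |K|, q, hq0, hq1, fun s hs => ?_⟩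
  obtain ⟨J, z, hJ, rfl⟩ := exists_eq_ofComplex hn s
  obtain ⟨h1, h2⟩ := h z fun w hw =>
    dist_ofComplex hJ z w ▸ hdist _ hs _ ((ofComplex_mem_sSpectrum hJ).2 hw)
  obtain ⟨h3, h4⟩ := h2 (vectorOp V J) (vectorOp_mul_self hJ)
    (fun m => leftResolventPow m (ofComplex J z) T) (leftResolventPow_zero _ _) fun m => by
      rw [leftResolventPow_succ, scalarOp_conj_ofComplex, quadOp_ofComplex hJ]
  refine ⟨fun h => (ofComplex_mem_sSpectrum hJ).1 h h1, ?_, fun m => (h4 m).trans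
    (one_add_mul_mul_le (norm_vectorOp_le hJ) (norm_nonneg _) (by positivity))⟩
  rw [leftResolvent, scalarOp_conj_ofComplex, quadOp_ofComplex hJ, ← mul_neg, neg_sub]
  exact h3

/-- Passing to the opposite algebra exchanges the left and right recursions and preserves norms and
invertibility. -/
theorem exists_hasSum_rightResolvent (hn : 1 ≤ n) (hTN : T * N = N * T) (hε : 0 < ε)
    (hNε : sSpectrum N ⊆ Metric.ball 0 ε) (hC : ENNReal.ofReal ε < setDist C (sSpectrum T)) :
    ∃ K q : ℝ, 0 ≤ q ∧ q < 1 ∧ ∀ s ∈ C,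
      HasSum (fun m : ℕ => rightResolventPow (m + 1) s T * N ^ m) (rightResolvent s (T + N)) ∧
      ∀ m, ‖rightResolventPow (m + 1) s T * N ^ m‖ ≤ K * q ^ m := by
  obtain ⟨d, hd, hdist⟩ := exists_lt_le_dist_of_lt_setDist hC
  obtain ⟨K, q, hq0, hq1, h⟩ := exists_hasSum_pow_mul (MulOpposite.op T) (MulOpposite.op N)
    (congrArg MulOpposite.op hTN.symm) hε hd fun w hw =>
      norm_lt_of_sSpectrum_subset_ball hn hNε w (by rwa [quadAt_op, isUnit_op] at hw)
  refine ⟨(1 + ∑ k : Fin n, ‖unitOp V k‖) * |K|, q, hq0, hq1, fun s hs => ?_⟩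
  obtain ⟨J, z, hJ, rfl⟩ := exists_eq_ofComplex hn s
  obtain ⟨-, h2⟩ := h z fun w hw => by
    rw [quadAt_op, isUnit_op] at hw
    exact dist_ofComplex hJ z w ▸ hdist _ hs _ ((ofComplex_mem_sSpectrum hJ).2 hw)
  obtain ⟨h3, h4⟩ := h2 (MulOpposite.op (vectorOp V J))
    (congrArg MulOpposite.op (vectorOp_mul_self hJ))
    (fun m => MulOpposite.op (rightResolventPow m (ofComplex J z) T))
    (congrArg MulOpposite.op (rightResolventPow_zero _ _)) fun m => by
      rw [rightResolventPow_succ, scalarOp_conj_ofComplex, quadOp_ofComplex hJ, quadAt_op,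
        inverse_op]
      rfl
  refine ⟨?_, fun m => (h4 m).trans
    (one_add_mul_mul_le (norm_vectorOp_le hJ) (norm_nonneg _) (by positivity))⟩
  rw [rightResolvent, scalarOp_conj_ofComplex, quadOp_ofComplex hJ, ← neg_mul, neg_sub]
  rw [← MulOpposite.op_add, quadAt_op, inverse_op] at h3
  exact hasSum_op.1 h3

end Operators

end SCalc

end SliceCalculus



theorem theorem6p4 {V : Type*} [NormedAddCommGroup V] [NormedSpace ℝ V] [CompleteSpace V]
    (n : ℕ) (hn : 1 ≤ n) (T N : BVn n V) (hT : T ∈ B01 n V) (hN : N ∈ B01 n V)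
    (hTN : T * N = N * T) (ε : ℝ) (hε : 0 < ε)
    (hNε : sSpectrum N ⊆ Metric.ball 0 ε) :
    (∀ s ∈ sResolventSet T, ENNReal.ofReal ε < setDist {s} (sSpectrum T) →
      s ∈ sResolventSet (T + N) ∧
      HasSum (fun m : ℕ => N ^ m * leftResolventPow (m + 1) s T) (leftResolvent s (T + N)) ∧
      HasSum (fun m : ℕ => rightResolventPow (m + 1) s T * N ^ m) (rightResolvent s (T + N))) ∧
    (∀ C : Set (Paravector n), ENNReal.ofReal ε < setDist C (sSpectrum T) →
      TendstoUniformlyOn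
        (fun (M : ℕ) s => ∑ m ∈ Finset.range M, N ^ m * leftResolventPow (m + 1) s T)
        (fun s => leftResolvent s (T + N)) Filter.atTop C ∧
      TendstoUniformlyOn
        (fun (M : ℕ) s => ∑ m ∈ Finset.range M, rightResolventPow (m + 1) s T * N ^ m)
        (fun s => rightResolvent s (T + N)) Filter.atTop C) := by
  refine ⟨fun s _ hsd => ?_, fun C hC => ⟨?_, ?_⟩⟩
  -- The pointwise claim is the case `C = {s}`.
  · obtain ⟨_, _, -, -, hl⟩ := exists_hasSum_leftResolvent hn hTN hε hNε hsd
    obtain ⟨_, _, -, -, hr⟩ := exists_hasSum_rightResolvent hn hTN hε hNε hsd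
    exact ⟨(hl s rfl).1, (hl s rfl).2.1, (hr s rfl).1⟩
  · obtain ⟨K, q, hq0, hq1, h⟩ := exists_hasSum_leftResolvent hn hTN hε hNε hC
    -- Weierstrass M-test: `K` and `q` were chosen before `s`.
    exact (tendstoUniformlyOn_tsum_nat ((summable_geometric_of_lt_one hq0 hq1).mul_left K)
      fun m s hs => (h s hs).2.2 m).congr_right fun s hs => (h s hs).2.1.tsum_eq
  · obtain ⟨K, q, hq0, hq1, h⟩ := exists_hasSum_rightResolvent hn hTN hε hNε hC
    exact (tendstoUniformlyOn_tsum_nat ((summable_geometric_of_lt_one hq0 hq1).mul_left K)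
      fun m s hs => (h s hs).2 m).congr_right fun s hs => (h s hs).1.tsum_eq
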